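/- Let $k \ge 2$ be an integer. For a sequence $f:\mathbb{N}\to\mathbb{Z}$ (with $0\in\mathbb{N}$), its $k$-kernel is the set of subsequences $\{f(k^\ell n+r)\}_{n\ge 0}$ with $\ell\ge 0$ and $0\le r<k^\ell$, and $f$ is called $k$-regular if the $\mathbb{Z}$-submodule of the module of all integer-valued sequences generated by its $k$-kernel is finitely generated. For a word $w=i_s\cdots i_1i_0$ over the alphabet $\{0,1,\ldots,k-1\}$ write $[w]_k=i_sk^s+\cdots+i_1k+i_0$ (so the empty word has value $0$), and let $y^n$ denote the $n$-fold concatenation of a word $y$ with itself. Let $f:\mathbb{N}\to\mathbb{Z}$ be an unbounded $k$-regular sequence. Then: (1) there is a constant $c>0$ such that $|f(n)|>c\log n$ for infinitely many $n$; (2) there exist an integer $m$, words $u_1,\ldots,u_m,y,v_1,\ldots,v_m\in\{0,1,\ldots,k-1\}^*$ and a constant $c_0>0$ such that for all sufficiently large $n$ there are $i,j\in\{1,\ldots,m\}$ with $|f([u_i\,y^n\,v_j]_k)|\ge c_0 n$. -/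

import Mathlib

/-- The `k`-kernel of `f : ℕ → ℤ`: the set of all subsequences `n ↦ f (k ^ l * n + r)` with
`l ≥ 0` and `0 ≤ r < k ^ l`. -/
def kKernel (k : ℕ) (f : ℕ → ℤ) : Set (ℕ → ℤ) :=
  {g | ∃ l r : ℕ, r < k ^ l ∧ g = fun n => f (k ^ l * n + r)}

/-- `f : ℕ → ℤ` is `k`-regular if the `ℤ`-submodule of the module of all integer sequences that
is generated by the `k`-kernel of `f` is finitely generated. -/
def IsKRegular (k : ℕ) (f : ℕ → ℤ) : Prop :=
  (Submodule.span ℤ (kKernel k f)).FG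

/-- The natural number `[w]_k = i_s k ^ s + ⋯ + i_1 k + i_0` of a word `w = i_s ⋯ i_1 i_0` over
the alphabet `{0, …, k - 1}`, the most significant letter coming first; the empty word gives `0`. -/
def wordValue {k : ℕ} (w : List (Fin k)) : ℕ :=
  Nat.ofDigits k (w.reverse.map (fun i => (i : ℕ)))

/-- The `n`-fold concatenation `y ^ n` of a word `y` with itself. -/
def wordPow {k : ℕ} (y : List (Fin k)) (n : ℕ) : List (Fin k) :=
  (List.replicate n y).flatten

/-!
Let `V` be the span of the `k`-kernel of `f`, a finitely generated free `ℤ`-module. Words `w` over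
the alphabet `{0, …, k - 1}` act on `V` by endomorphisms `ρ w` such that
`(ρ w g) [u] = g [u w]` (`wordAction_wordValue`); in particular `f [w] = (ρ w f) 0`, so if `f` is
unbounded, then `ρ` has infinite range.

By the theorem of McNaughton and Zalcstein (`finite_range_of_torsion`), a finitely generated monoid
of rational matrices in which every element has finitely many powers is finite. Hence the powers of
`ρ y` are infinite in number for some word `y`. The proof of that theorem is by induction on the
dimension. In the irreducible case the trace form is nondegenerate and traces of torsion elements
are bounded integers (`finite_range_of_irreducible`). If there is an invariant subspace, Ramsey's theorem
finds in each long word three consecutive factors that act on the subspace and on the quotient as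
the same idempotent; torsion makes the middle one superfluous, so every element of the monoid is
represented by a word of bounded length (`FreeMonoid.finite_range_of_forget_middle`,
`forget_middle_of_invariant`).

An integral endomorphism `T` with infinitely many powers has either an eigenvalue outside the unit
disc or, by Kronecker's theorem, a power `T ^ m` which is unipotent, and not the identity, on the
image of its high powers; in both cases the powers of some `T ^ m` grow at least linearly
(`exists_linear_growth_of_not_torsion`). For `T = ρ y` this growth shows in the values at one point
`[u]` of the images of finitely many kernel elements `ρ (v j) f` that span `V`, that is, in the
numbers `f [u y ^ (m * n) v j]`. The logarithmic bound follows, as `log [u y ^ n v]` is at most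
linear in `n`.
-/

/-! ### Ramsey's theorem for factors of words -/

/-- A large enough set of natural numbers contains a subset of prescribed size on which the
colour of a pair depends only on its smaller element. -/
theorem exists_card_le_endHomogeneous (T : Type*) [Finite T] (N : ℕ) :
    ∃ L : ℕ, ∀ (c : ℕ → ℕ → T) (S : Finset ℕ), L ≤ S.card →
      ∃ t ⊆ S, N ≤ t.card ∧ ∃ d : ℕ → T, ∀ x ∈ t, ∀ y ∈ t, x < y → c x y = d x := by
  classical
  have := Fintype.ofFinite T
  induction N with
  | zero =>
    refine ⟨0, fun c S _ => ⟨∅, by simp, by simp, fun x => c x x, by simp⟩⟩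
  | succ N ih =>
    obtain ⟨L, hL⟩ := ih
    refine ⟨Fintype.card T * L + 1, fun c S hS => ?_⟩
    have hne : S.Nonempty := Finset.card_pos.mp (by omega)
    set m := S.min' hne with hm
    have hmS : m ∈ S := S.min'_mem hne
    have hcard : Fintype.card T * L ≤ (S.erase m).card := by
      rw [Finset.card_erase_of_mem hmS]; omega
    obtain ⟨e, -, he⟩ := Finset.exists_le_card_fiber_of_mul_le_card_of_maps_to
      (s := S.erase m) (t := Finset.univ) (f := c m) (n := L) (by simp) ⟨c m m, by simp⟩
      (by simpa using hcard)
    obtain ⟨t, hts, htN, d, hd⟩ := hL c _ he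
    have hsub : ∀ x ∈ t, x ∈ S ∧ m < x ∧ c m x = e := by
      intro x hx
      have h := hts hx
      simp only [Finset.mem_filter, Finset.mem_erase] at h
      exact ⟨h.1.2, lt_of_le_of_ne (S.min'_le x h.1.2) (Ne.symm h.1.1), h.2⟩
    have hmt : m ∉ t := fun h => lt_irrefl _ (hsub m h).2.1
    refine ⟨insert m t, ?_, ?_, Function.update d m e, ?_⟩
    · intro x hx
      rcases Finset.mem_insert.mp hx with rfl | hx
      · exact hmS
      · exact (hsub x hx).1
    · rw [Finset.card_insert_of_notMem hmt]; omega
    · intro x hx y hy hxy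
      rcases Finset.mem_insert.mp hx with rfl | hx
      · rcases Finset.mem_insert.mp hy with rfl | hy
        · exact absurd hxy (lt_irrefl _)
        · simpa using (hsub y hy).2.2
      · have hxm : x ≠ m := fun h => hmt (h ▸ hx)
        rw [Function.update_of_ne hxm]
        rcases Finset.mem_insert.mp hy with rfl | hy
        · exact absurd hxy (not_lt.mpr (hsub x hx).2.1.le)
        · exact hd x hx y hy hxy

/-- The part of Ramsey's theorem for four points that concerns the three pairs of consecutive
points and one composite pair. Their common colour is idempotent when colours are
values of a homomorphism on factors of a word. -/
theorem exists_four_homogeneous (T : Type*) [Finite T] :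
    ∃ L : ℕ, ∀ c : ℕ → ℕ → T, ∃ i j k l : ℕ, i < j ∧ j < k ∧ k < l ∧ l < L ∧
      c i j = c i k ∧ c j k = c i k ∧ c k l = c i k := by
  classical
  have := Fintype.ofFinite T
  obtain ⟨L, hL⟩ := exists_card_le_endHomogeneous T (Fintype.card T * 3 + 1)
  refine ⟨L, fun c => ?_⟩
  obtain ⟨t, htL, htN, d, hd⟩ := hL c (Finset.range L) (by simp)
  obtain ⟨e, -, he⟩ := Finset.exists_lt_card_fiber_of_mul_lt_card_of_maps_to
      (s := t) (t := Finset.univ) (f := d) (n := 3) (by simp) (by simp; omega)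
  obtain ⟨u, hu, hu4⟩ := Finset.exists_subset_card_eq (show 4 ≤ (t.filter (d · = e)).card from he)
  let p := u.orderEmbOfFin hu4
  have hp : ∀ a, p a ∈ t ∧ d (p a) = e := fun a => by
    simpa using hu (u.orderEmbOfFin_mem hu4 a)
  have hc : ∀ a b, a < b → c (p a) (p b) = e := fun a b hab => by
    rw [hd _ (hp a).1 _ (hp b).1 (p.strictMono hab), (hp a).2]
  refine ⟨p 0, p 1, p 2, p 3, p.strictMono (by decide), p.strictMono (by decide),
    p.strictMono (by decide), ?_, ?_, ?_, ?_⟩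
  · simpa using htL (hp 3).1
  all_goals rw [hc _ _ (by decide), hc _ _ (by decide)]

theorem List.drop_take_append_drop_take {α : Type*} (w : List α) {i j k : ℕ} (hij : i ≤ j)
    (hjk : j ≤ k) : (w.take j).drop i ++ (w.take k).drop j = (w.take k).drop i := by
  conv_rhs => rw [← List.take_append_drop (j - i) ((w.take k).drop i)]
  rw [List.drop_drop, List.take_drop, List.take_take]
  congr <;> omega

/-- A Ramsey-type criterion for the finiteness of a finitely generated monoid. If `φ` has finite
range, and `ρ` forgets the middle factor of `x * y * z` whenever `x`, `y`, `z` have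
the same idempotent image under `φ`, then `ρ` has finite range: every long word contains such a
product and can be shortened. -/
theorem FreeMonoid.finite_range_of_forget_middle {ι M N : Type*} [Finite ι] [Monoid M] [Monoid N]
    (ρ : FreeMonoid ι →* M) (φ : FreeMonoid ι →* N) (hφ : (Set.range φ).Finite)
    (h : ∀ x y z, φ x = φ y → φ z = φ y → φ y * φ y = φ y → ρ (x * y * z) = ρ (x * z)) :
    (Set.range ρ).Finite := by
  have : Finite (Set.range φ) := hφ
  obtain ⟨L, hL⟩ := exists_four_homogeneous (Set.range φ)
  have key : ∀ (n : ℕ) (w : List ι), w.length = n →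
      ∃ w' : List ι, w'.length < L ∧ ρ (ofList w') = ρ (ofList w) := by
    intro n
    induction n using Nat.strong_induction_on with
    | _ n ih =>
    intro w hw
    by_cases hwL : w.length < L
    · exact ⟨w, hwL, rfl⟩
    obtain ⟨i, j, k, l, hij, hjk, hkl, hl, h1, h2, h3⟩ :=
      hL (fun a b => ⟨φ (ofList ((w.take b).drop a)), _, rfl⟩)
    replace h1 := congrArg Subtype.val h1
    replace h2 := congrArg Subtype.val h2
    replace h3 := congrArg Subtype.val h3
    dsimp only at h1 h2 h3
    set x := (w.take j).drop i
    set y := (w.take k).drop j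
    set z := (w.take l).drop k
    have hxy : x ++ y = (w.take k).drop i := w.drop_take_append_drop_take hij.le hjk.le
    have hyz : y ++ z = (w.take l).drop j := w.drop_take_append_drop_take hjk.le hkl.le
    have hxyz : x ++ (y ++ z) = (w.take l).drop i := by
      rw [hyz]; exact w.drop_take_append_drop_take hij.le (by omega)
    have hdec : w = w.take i ++ (x ++ (y ++ z)) ++ w.drop l := by
      have h0 : w.take i = (w.take i).drop 0 := by simp
      rw [hxyz, h0, w.drop_take_append_drop_take (Nat.zero_le i) (by omega)]
      simp
    have hred := h (ofList x) (ofList y) (ofList z) (h1.trans h2.symm) (h3.trans h2.symm) (by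
      have e : φ (ofList x) * φ (ofList y) = φ (ofList ((w.take k).drop i)) := by
        rw [← hxy, ofList_append, map_mul]
      rwa [h1, ← h2] at e)
    have hy : 0 < y.length := by
      simp only [y, List.length_drop, List.length_take]
      omega
    have hlen : (w.take i ++ (x ++ z) ++ w.drop l).length < n := by
      rw [← hw]
      conv_rhs => rw [hdec]
      simp only [List.length_append]
      omega
    obtain ⟨w', hw', he⟩ := ih _ hlen _ rfl
    refine ⟨w', hw', he.trans ?_⟩
    conv_rhs => rw [hdec]
    simp only [ofList_append, map_mul] at hred ⊢
    simp only [← mul_assoc] at hred ⊢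
    simp only [mul_assoc, ← hred]
  refine ((List.finite_length_lt ι L).image (fun w => ρ (ofList w))).subset ?_
  rintro _ ⟨w, rfl⟩
  obtain ⟨w', hw', he⟩ := key _ (toList w) rfl
  exact ⟨w', hw', he⟩

/-! ### Finitely generated torsion monoids of rational endomorphisms -/

/-- In coordinates adapted to `W`, let `X`, `Y`, `Z` have the same diagonal blocks `A` and `B`, both
idempotent. Then the off-diagonal block of `X * Y * Z - X * Z` is `A * C * B`, with `C` that of `Y`,
and the powers of `Y` drift by `A * C * B` at each step. If `Y` is torsion, the drift is zero. -/
theorem forget_middle_of_invariant {K V : Type*} [Field K] [CharZero K] [AddCommGroup V]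
    [Module K V] (W : Submodule K V) (X Y Z : Module.End K V)
    (hYW : ∀ v ∈ W, Y v ∈ W) (hX : ∀ v ∈ W, X v = Y v)
    (hZ : ∀ v, Z v - Y v ∈ W) (hY : ∀ v ∈ W, Y (Y v) = Y v) (hY' : ∀ v, Y (Y v) - Y v ∈ W)
    (htors : ∃ a p : ℕ, 0 < p ∧ Y ^ (a + p) = Y ^ a) : X * Y * Z = X * Z := by
  -- `D` is the drift of the powers of `Y`
  set D : Module.End K V := Y * Y * Y - Y * Y with hD
  have hYD : Y * D = D := by
    ext v
    have := hY _ (hY' v)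
    simp only [map_sub] at this
    simpa [hD] using this
  have hpow : ∀ n : ℕ, Y ^ (n + 2) = Y ^ 2 + (n : K) • D := by
    intro n
    induction n with
    | zero => simp
    | succ n ih =>
      rw [show n + 1 + 2 = (n + 2) + 1 by ring, pow_succ', ih, mul_add, mul_smul_comm, hYD, hD]
      push_cast
      rw [add_smul, one_smul, pow_two]
      simp only [mul_assoc]
      abel
  have hD0 : D = 0 := by
    obtain ⟨a, p, hp, h⟩ := htors
    have h2 : Y ^ (a + p + 2) = Y ^ (a + 2) := by rw [pow_add, h, ← pow_add]
    rw [hpow (a + p), hpow a, add_right_inj, ← sub_eq_zero, ← sub_smul] at h2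
    rcases smul_eq_zero.mp h2 with h3 | h3
    · push_cast at h3
      have : (p : K) = 0 := by linear_combination h3
      exact absurd (Nat.cast_eq_zero.mp this) hp.ne'
    · exact h3
  ext v
  have hq : Y (Z v) - Z v ∈ W := by
    have : Y (Z v) - Z v = Y (Z v - Y v) + (Y (Y v) - Y v) - (Z v - Y v) := by
      simp only [map_sub]; abel
    rw [this]
    exact W.sub_mem (W.add_mem (hYW _ (hZ v)) (hY' v)) (hZ v)
  have h1 := hX _ hq
  have h2 := hY _ (hZ v)
  have h3 : D v = 0 := by rw [hD0]; rfl
  simp only [hD, map_sub, LinearMap.sub_apply, Module.End.mul_apply] at h1 h2 h3 ⊢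
  rw [← sub_eq_zero, h1, ← h3, sub_eq_sub_iff_sub_eq_sub, h2]

/-- The trace of a torsion endomorphism of a rational vector space is a sum of at most
`dim V` roots of unity, hence an integer of absolute value at most `dim V`. -/
theorem trace_mem_of_torsion {V : Type*} [AddCommGroup V] [Module ℚ V] [FiniteDimensional ℚ V]
    (Y : Module.End ℚ V) (htors : ∃ a p : ℕ, 0 < p ∧ Y ^ (a + p) = Y ^ a) :
    LinearMap.trace ℚ V Y ∈ (fun n : ℤ => (n : ℚ)) ''
      Set.Icc (-(Module.finrank ℚ V : ℤ)) (Module.finrank ℚ V) := by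
  obtain ⟨a, p, hp, h⟩ := htors
  let b := Module.finBasis ℚ V
  set d := Module.finrank ℚ V
  set B : Matrix (Fin d) (Fin d) ℂ :=
    (algebraMap ℚ ℂ).mapMatrix (LinearMap.toMatrixAlgEquiv b Y) with hB
  have hBpow : B ^ (a + p) = B ^ a := by
    rw [hB, ← map_pow, ← map_pow, h, map_pow, map_pow]
  have hroot : ∀ z ∈ B.charpoly.roots, z ≠ 0 → z ^ p = 1 := by
    intro z hz hz0
    have hz := Matrix.mem_spectrum_iff_isRoot_charpoly.mpr (Polynomial.isRoot_of_mem_roots hz)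
    rcases Nat.eq_zero_or_pos d with hd | hd
    · have : IsEmpty (Fin d) := by rw [hd]; infer_instance
      simp [spectrum.of_subsingleton] at hz
    have : Nonempty (Fin d) := ⟨⟨0, hd⟩⟩
    have hzp := spectrum.subset_polynomial_aeval B
      (Polynomial.X ^ (a + p) - Polynomial.X ^ a : Polynomial ℂ) ⟨z, hz, rfl⟩
    have hzp : z ^ (a + p) = z ^ a := by
      simpa [hBpow, spectrum.zero_eq, sub_eq_zero] using hzp
    rw [pow_add] at hzp
    exact mul_left_cancel₀ (pow_ne_zero a hz0) (by rw [hzp, mul_one])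
  have htr : ((LinearMap.trace ℚ V Y : ℚ) : ℂ) = B.charpoly.roots.sum := by
    rw [← Matrix.trace_eq_sum_roots_charpoly, LinearMap.trace_eq_matrix_trace ℚ b, hB]
    exact AddMonoidHom.map_trace (algebraMap ℚ ℂ) _
  have hint : IsIntegral ℤ (LinearMap.trace ℚ V Y) := by
    have : IsIntegral ℤ ((algebraMap ℚ ℂ) (LinearMap.trace ℚ V Y)) := by
      change IsIntegral ℤ ((LinearMap.trace ℚ V Y : ℚ) : ℂ)
      rw [htr]
      refine IsIntegral.multiset_sum fun z hz => ?_
      rcases eq_or_ne z 0 with rfl | h0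
      · exact isIntegral_zero
      · exact IsIntegral.of_pow hp (by rw [hroot z hz h0]; exact isIntegral_one)
    exact (isIntegral_algebraMap_iff (algebraMap ℚ ℂ).injective).mp this
  obtain ⟨n, hn⟩ := IsIntegrallyClosed.isIntegral_iff.mp hint
  refine ⟨n, ?_, by simpa using hn⟩
  have hn' : (LinearMap.trace ℚ V Y : ℚ) = n := by simpa using hn.symm
  have hnorm : ‖B.charpoly.roots.sum‖ ≤ d := by
    have h1 : ∀ z ∈ B.charpoly.roots, ‖z‖ ≤ 1 := by
      intro z hz
      rcases eq_or_ne z 0 with rfl | h0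
      · simp
      · exact (Complex.norm_eq_one_of_pow_eq_one (hroot z hz h0) hp.ne').le
    calc _ ≤ (B.charpoly.roots.map (‖·‖)).sum := norm_multiset_sum_le _
      _ ≤ (B.charpoly.roots.map (‖·‖)).card • 1 := by
          refine Multiset.sum_le_card_nsmul _ _ fun x hx => ?_
          obtain ⟨z, hz, rfl⟩ := Multiset.mem_map.mp hx
          exact h1 z hz
      _ ≤ d := by
          have := B.charpoly.card_roots'
          rw [Matrix.charpoly_natDegree_eq_dim, Fintype.card_fin] at this
          simpa using this
  rw [← htr, hn'] at hnorm
  have : |(n : ℝ)| ≤ d := by simpa using hnorm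
  rw [abs_le] at this
  exact ⟨by exact_mod_cast this.1, by exact_mod_cast this.2⟩

open Polynomial in
/-- If `c` fixes a nonzero vector, some polynomial in `c` without constant term is a nonzero
idempotent, and its trace, the rank, is nonzero. -/
theorem exists_trace_mul_aeval_ne_zero {K V : Type*} [Field K] [CharZero K] [AddCommGroup V]
    [Module K V] [FiniteDimensional K V] (c : Module.End K V) (x : V) (hx : x ≠ 0)
    (hc : c x = x) : ∃ g : K[X], LinearMap.trace K V (c * aeval c g) ≠ 0 := by
  obtain ⟨q, hq, hq1⟩ := exists_eq_pow_rootMultiplicity_mul_and_not_dvd c.charpoly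
    c.charpoly_monic.ne_zero 1
  set a := rootMultiplicity 1 c.charpoly
  have hcop : IsCoprime ((X - C 1 : K[X]) ^ (a + 1)) (X * q) := by
    refine IsCoprime.pow_left (IsCoprime.mul_right ?_ ?_)
    · exact ⟨-1, 1, by simp⟩
    · exact ((irreducible_X_sub_C (1 : K)).coprime_iff_not_dvd).mpr hq1
  obtain ⟨u, w, huw⟩ := hcop
  refine ⟨w * q, fun htr => hx ?_⟩
  have hE : c * aeval c (w * q) = aeval c (w * (X * q)) := by
    rw [show w * (X * q) = X * (w * q) by ring, map_mul (aeval (R := K) c) X, aeval_X]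
  rw [hE] at htr
  set E := aeval c (w * (X * q)) with hEdef
  have hidem : IsIdempotentElem E := by
    have h0 : E * (1 - E) = 0 := by
      have : (1 : Module.End K V) - E = aeval c (u * (X - C 1) ^ (a + 1)) := by
        rw [hEdef, ← map_one (aeval (R := K) c), ← map_sub, ← huw]; ring_nf
      rw [this, hEdef, ← map_mul, show w * (X * q) * (u * (X - C 1) ^ (a + 1)) =
        w * X * u * (X - C 1) * ((X - C 1) ^ a * q) by ring, ← hq, map_mul,
        LinearMap.aeval_self_charpoly, mul_zero]
    rw [mul_sub, mul_one, sub_eq_zero] at h0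
    exact h0.symm
  have hE0 : E = 0 := LinearMap.IsIdempotentElem.eq_zero_of_trace_eq_zero hidem htr
  have h1 : aeval c (u * (X - C 1) ^ (a + 1)) + E = 1 := by
    rw [hEdef, ← map_add, huw, map_one]
  have h2 := LinearMap.congr_fun h1 x
  rw [hE0, add_zero, pow_succ, ← mul_assoc, map_mul] at h2
  simpa [hc] using h2.symm

/-- The trace form of an irreducible algebra of endomorphisms is nondegenerate. -/
theorem eq_zero_of_trace_mul_eq_zero {K V : Type*} [Field K] [CharZero K] [AddCommGroup V]
    [Module K V] [FiniteDimensional K V] (R : Subalgebra K (Module.End K V))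
    (hirr : ∀ W : Submodule K V, (∀ r ∈ R, ∀ v ∈ W, r v ∈ W) → W = ⊥ ∨ W = ⊤)
    (a : Module.End K V) (ha : a ∈ R) (htr : ∀ r ∈ R, LinearMap.trace K V (a * r) = 0) :
    a = 0 := by
  by_contra hne
  obtain ⟨v, hv⟩ : ∃ v, a v ≠ 0 := by
    by_contra! h
    exact hne (LinearMap.ext h)
  have hv0 : v ≠ 0 := by rintro rfl; simp at hv
  -- irreducibility gives `b ∈ R` for which `b * a` fixes `v`
  let W : Submodule K V := (Subalgebra.toSubmodule R).map (LinearMap.applyₗ (a v))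
  have hW : W = ⊤ := by
    refine (hirr W ?_).resolve_left ?_
    · rintro r hr _ ⟨s, hs, rfl⟩
      exact ⟨r * s, R.mul_mem hr hs, rfl⟩
    · intro h
      have : a v ∈ W := ⟨1, R.one_mem, rfl⟩
      rw [h] at this
      exact hv (by simpa using this)
  obtain ⟨b, hb, hbv⟩ : v ∈ W := hW ▸ Submodule.mem_top
  obtain ⟨g, hg⟩ := exists_trace_mul_aeval_ne_zero (b * a) v hv0 (by simpa using hbv)
  apply hg
  rw [mul_assoc, LinearMap.trace_mul_comm, mul_assoc]
  refine htr _ (R.mul_mem ?_ hb)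
  have hba : b * a ∈ R := R.mul_mem hb ha
  exact Algebra.adjoin_le (Set.singleton_subset_iff.mpr hba)
    (Polynomial.aeval_mem_adjoin_singleton K _)

/-- Irreducible case: an element of the monoid is determined by the traces of its products with
finitely many elements that span the algebra, and these traces take finitely many values. -/
theorem finite_range_of_irreducible {G V : Type*} [Monoid G] [AddCommGroup V] [Module ℚ V]
    [FiniteDimensional ℚ V] (ρ : G →* Module.End ℚ V)
    (hirr : ∀ W : Submodule ℚ V, (∀ g, ∀ v ∈ W, ρ g v ∈ W) → W = ⊥ ∨ W = ⊤)
    (htors : ∀ g, ∃ a p : ℕ, 0 < p ∧ ρ g ^ (a + p) = ρ g ^ a) : (Set.range ρ).Finite := by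
  let R := Algebra.adjoin ℚ (Set.range ρ)
  have hR : Subalgebra.toSubmodule R = Submodule.span ℚ (Set.range ρ) := by
    have := Algebra.adjoin_eq_span ℚ (Set.range ρ)
    rwa [← MonoidHom.coe_mrange, Submonoid.closure_eq] at this
  have hfg : (Submodule.span ℚ (Set.range ρ)).FG := IsNoetherian.noetherian _
  obtain ⟨s, hs, hspan⟩ := (Submodule.fg_span_iff_fg_span_finset_subset _).mp hfg
  set F : Set ℚ := (fun n : ℤ => (n : ℚ)) ''
      Set.Icc (-(Module.finrank ℚ V : ℤ)) (Module.finrank ℚ V)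
  have hF : F.Finite := (Set.finite_Icc _ _).image _
  refine Set.Finite.of_finite_image (f := fun M (r : s) => LinearMap.trace ℚ V (M * r.1)) 
    ((Set.Finite.pi' (fun _ : s => hF)).subset ?_) ?_
  · rintro _ ⟨_, ⟨g, rfl⟩, rfl⟩ ⟨r, hr⟩
    obtain ⟨g', rfl⟩ := hs hr
    simp only [← map_mul]
    exact trace_mem_of_torsion _ (htors _)
  · rintro _ ⟨g, rfl⟩ _ ⟨g', rfl⟩ h
    refine sub_eq_zero.mp (eq_zero_of_trace_mul_eq_zero R ?_ _ ?_ ?_)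
    · exact fun W hW => hirr W fun g => hW _ (Algebra.subset_adjoin ⟨g, rfl⟩)
    · exact R.sub_mem (Algebra.subset_adjoin ⟨g, rfl⟩) (Algebra.subset_adjoin ⟨g', rfl⟩)
    · intro r hr
      replace hr : r ∈ Submodule.span ℚ (s : Set (Module.End ℚ V)) := by
        rw [← hspan, ← hR]; exact hr
      induction hr using Submodule.span_induction with
      | mem x hx =>
        have := congrFun h ⟨x, hx⟩
        simp only at this
        rw [sub_mul, map_sub, this, sub_self]
      | zero => simp
      | add x y _ _ hx hy => rw [mul_add, map_add, hx, hy, add_zero]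
      | smul q x _ hx => rw [mul_smul_comm, map_smul, hx, smul_zero]

/-- Induction on the dimension. Given an invariant subspace `W`, the actions on `W` and `V ⧸ W` have
finite range, and words with the same idempotent image in both can be shortened. -/
theorem finite_range_of_torsion_aux {ι : Type*} [Finite ι] (n : ℕ) :
    ∀ (V : Type*) [AddCommGroup V] [Module ℚ V] [FiniteDimensional ℚ V],
      Module.finrank ℚ V ≤ n → ∀ ρ : FreeMonoid ι →* Module.End ℚ V,
      (∀ g, ∃ a p : ℕ, 0 < p ∧ ρ g ^ (a + p) = ρ g ^ a) → (Set.range ρ).Finite := by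
  induction n with
  | zero =>
    intro V _ _ _ hn ρ _
    have : Subsingleton V := Module.finrank_zero_iff.mp (Nat.le_zero.mp hn)
    exact Set.toFinite _
  | succ n ih =>
    intro V _ _ _ hn ρ htors
    by_cases hirr : ∀ W : Submodule ℚ V, (∀ g, ∀ v ∈ W, ρ g v ∈ W) → W = ⊥ ∨ W = ⊤
    · exact finite_range_of_irreducible ρ hirr htors
    push Not at hirr
    obtain ⟨W, hW, hbot, htop⟩ := hirr
    have hWr : Module.finrank ℚ W < Module.finrank ℚ V := Submodule.finrank_lt htop
    have hQr := W.finrank_quotient_add_finrank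
    have hW0 : 0 < Module.finrank ℚ W := Submodule.one_le_finrank_iff.mpr hbot
    let ρ₁ : FreeMonoid ι →* Module.End ℚ W :=
      { toFun := fun g => (ρ g).restrict (hW g)
        map_one' := by ext; simp
        map_mul' := fun g h => by ext; simp }
    let ρ₂ : FreeMonoid ι →* Module.End ℚ (V ⧸ W) :=
      { toFun := fun g => W.mapQ W (ρ g) (hW g)
        map_one' := by ext; simp
        map_mul' := fun g h => by ext; simp }
    have hfin₁ : (Set.range ρ₁).Finite := by
      refine ih W (by omega) ρ₁ fun g => ?_
      obtain ⟨a, p, hp, h⟩ := htors g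
      refine ⟨a, p, hp, ?_⟩
      simp only [← map_pow] at h ⊢
      ext v
      simpa [ρ₁] using LinearMap.congr_fun h v
    have hfin₂ : (Set.range ρ₂).Finite := by
      refine ih (V ⧸ W) (by omega) ρ₂ fun g => ?_
      obtain ⟨a, p, hp, h⟩ := htors g
      refine ⟨a, p, hp, ?_⟩
      simp only [← map_pow] at h ⊢
      ext v
      simp [ρ₂, h]
    refine FreeMonoid.finite_range_of_forget_middle ρ (ρ₁.prod ρ₂)
      ((hfin₁.prod hfin₂).subset ?_) fun x y z hxy hzy hyy => ?_
    · rintro _ ⟨g, rfl⟩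
      exact ⟨⟨g, rfl⟩, ⟨g, rfl⟩⟩
    have h₁ : ∀ g h, ρ₁ g = ρ₁ h → ∀ v ∈ W, ρ g v = ρ h v := fun g h e v hv =>
      congrArg Subtype.val (LinearMap.congr_fun e ⟨v, hv⟩)
    have h₂ : ∀ g h, ρ₂ g = ρ₂ h → ∀ v, ρ g v - ρ h v ∈ W := fun g h e v =>
      (Submodule.Quotient.eq W).mp (LinearMap.congr_fun e (W.mkQ v))
    rw [← map_mul] at hyy
    have hy₁ := h₁ _ _ (congrArg Prod.fst hyy)
    have hy₂ := h₂ _ _ (congrArg Prod.snd hyy)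
    simp only [map_mul, Module.End.mul_apply] at hy₁ hy₂ ⊢
    exact forget_middle_of_invariant W (ρ x) (ρ y) (ρ z) (hW y) (h₁ _ _ (congrArg Prod.fst hxy))
      (h₂ _ _ (congrArg Prod.snd hzy)) hy₁ hy₂ (htors y)

/-- The Burnside property for monoids of rational matrices (McNaughton and Zalcstein): a finitely
generated torsion monoid of endomorphisms of a finite-dimensional rational vector space is
finite. -/
theorem finite_range_of_torsion {ι V : Type*} [Finite ι] [AddCommGroup V] [Module ℚ V]
    [FiniteDimensional ℚ V] (ρ : FreeMonoid ι →* Module.End ℚ V)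
    (htors : ∀ g, ∃ a p : ℕ, 0 < p ∧ ρ g ^ (a + p) = ρ g ^ a) : (Set.range ρ).Finite :=
  finite_range_of_torsion_aux _ V le_rfl ρ htors

/-! ### Growth of the powers of an integral endomorphism -/

open Polynomial in
/-- A form of Kronecker's theorem: the nonzero complex roots of `q` are roots of unity, of orders
dividing some common `m`. -/
theorem exists_dvd_pow_of_norm_roots_le_one (q : ℤ[X]) (hq : q.Monic)
    (hroots : ∀ z ∈ (q.map (Int.castRingHom ℂ)).roots, ‖z‖ ≤ 1) :
    ∃ m r : ℕ, 0 < m ∧ q ∣ (X * (X ^ m - 1)) ^ r := by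
  classical
  set p := q.map (Int.castRingHom ℂ) with hp
  have hpm : p.Monic := hq.map _
  have hmahler : p.mahlerMeasure = 1 := by
    rw [mahlerMeasure_eq_leadingCoeff_mul_prod_roots, hpm.leadingCoeff, norm_one, one_mul]
    refine Multiset.prod_eq_one fun x hx => ?_
    obtain ⟨z, hz, rfl⟩ := Multiset.mem_map.mp hx
    exact max_eq_left (hroots z hz)
  have hpow : ∀ z : ℂ, ∃ n, 0 < n ∧ (z ∈ p.roots → z ≠ 0 → z ^ n = 1) := by
    intro z
    by_cases h : z ∈ p.roots ∧ z ≠ 0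
    · obtain ⟨n, hn, hz⟩ := pow_eq_one_of_mahlerMeasure_eq_one hmahler h.2 h.1
      exact ⟨n, hn, fun _ _ => hz⟩
    · exact ⟨1, one_pos, fun h1 h2 => absurd ⟨h1, h2⟩ h⟩
  choose n hn hz using hpow
  set m := ∏ z ∈ p.roots.toFinset, n z
  refine ⟨m, p.roots.card, Finset.prod_pos fun z _ => hn z, ?_⟩
  rw [← map_dvd_map (Int.castRingHom ℂ) Int.cast_injective hq]
  change p ∣ _
  rw [(IsAlgClosed.splits p).eq_prod_roots_of_monic hpm]
  have h : ∀ z ∈ p.roots, X - C z ∣ (X * (X ^ m - 1) : ℂ[X]) := by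
    intro z hzr
    rw [dvd_iff_isRoot, IsRoot.def]
    rcases eq_or_ne z 0 with rfl | h0
    · simp
    · obtain ⟨k, hk⟩ := Finset.dvd_prod_of_mem n (Multiset.mem_toFinset.mpr hzr)
      have : z ^ m = 1 := by
        rw [show m = n z * k from hk, pow_mul, hz z hzr h0, one_pow]
      simp [this]
  have := Multiset.prod_dvd_prod_of_dvd _ _ h
  simpa using this

/-- If a fixed linear combination of finitely many integer sequences grows at least linearly, then
at each large index one of the sequences is at least a constant multiple of the index. -/
theorem exists_linear_growth_of_sum {J : Type*} [Fintype J] (s : ℕ → J → ℤ) (x : J → ℂ) (C : ℝ)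
    (hC : 0 < C) (N : ℕ) (h : ∀ n : ℕ, N ≤ n → C * n ≤ ‖∑ j, x j * (s n j : ℂ)‖) :
    ∃ c : ℝ, 0 < c ∧ ∃ N : ℕ, ∀ n : ℕ, N ≤ n → ∃ j, c * n ≤ |(s n j : ℝ)| := by
  set S := ∑ j, ‖x j‖
  have hS : 0 ≤ S := Finset.sum_nonneg fun j _ => norm_nonneg _
  refine ⟨C / (S + 1), by positivity, N + 1, fun n hn => ?_⟩
  by_contra! hlt
  have hn0 : (0 : ℝ) < n := by exact_mod_cast (by omega : 0 < n)
  have h1 : ‖∑ j, x j * (s n j : ℂ)‖ ≤ S * (C / (S + 1) * n) := by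
    rw [Finset.sum_mul]
    refine (norm_sum_le _ _).trans (Finset.sum_le_sum fun j _ => ?_)
    rw [norm_mul, Complex.norm_intCast]
    exact mul_le_mul_of_nonneg_left (hlt j).le (norm_nonneg _)
  have h2 : S * (C / (S + 1) * n) < C * n := by
    have h3 : (S + 1) * (C / (S + 1) * n) = C * n := by field_simp
    have h4 : 0 < C / (S + 1) * n := by positivity
    linarith
  linarith [h n (by omega)]

/-- Integral vectors that are linearly independent over `ℤ` stay so over `ℂ`. -/
theorem eq_zero_of_sum_mul_intCast_eq_zero {ι X : Type*} [Fintype ι] (b : ι → X → ℤ)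
    (hb : LinearIndependent ℤ b) (x : ι → ℂ) (h : ∀ t, ∑ i, x i * (b i t : ℂ) = 0) : x = 0 := by
  have hbQ : LinearIndependent ℚ (fun i t => (b i t : ℚ)) := by
    rw [← LinearIndependent.iff_fractionRing (R := ℤ)]
    let E : (X → ℤ) →ₗ[ℤ] (X → ℚ) := (Int.castAddHom ℚ).toIntLinearMap.compLeft X
    refine hb.map' E (LinearMap.ker_eq_bot.mpr fun u v huv => funext fun t => ?_)
    exact Int.cast_injective (congrFun huv t)
  funext i
  -- a complex number is zero if every rational linear functional kills it
  refine (Module.forall_dual_apply_eq_zero_iff ℚ (x i)).mp fun φ => ?_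
  refine Fintype.linearIndependent_iff.mp hbQ (fun i => φ (x i)) (funext fun t => ?_) i
  have := congrArg φ (h t)
  rw [map_sum, map_zero] at this
  rw [Pi.zero_apply, ← this, Finset.sum_apply]
  refine Finset.sum_congr rfl fun j _ => ?_
  have e : x j * (b j t : ℂ) = (b j t : ℚ) • x j := by
    rw [Rat.smul_def, mul_comm]; simp
  rw [e, map_smul]
  simp [mul_comm]

section Growth

variable {V X J : Type*} [AddCommGroup V] [Fintype J] (e : V →ₗ[ℤ] (X → ℤ))
  (T : Module.End ℤ V) (g : J → V)

/-- Growth when the eigenvalues of `T` are zero or roots of unity: for the least `s` with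
`T ^ r * (T ^ m - 1) ^ s = 0` the hypothesis `hT` forces `2 ≤ s`, and on the image of
`T ^ r * (T ^ m - 1) ^ (s - 2)` the powers of `T ^ m` are affine in the exponent and not constant.
-/
theorem linear_growth_of_unipotent (he : Function.Injective e)
    (hT : ∀ a p : ℕ, 0 < p → T ^ (a + p) ≠ T ^ a)
    (hg : Submodule.span ℤ (Set.range g) = ⊤) (m r : ℕ) (hm : 0 < m)
    (hTm : T ^ r * (T ^ m - 1) ^ r = 0) :
    ∃ (t : X) (c : ℝ), 0 < c ∧
      ∃ N : ℕ, ∀ n : ℕ, N ≤ n → ∃ j, c * n ≤ |(e ((T ^ (m * n)) (g j)) t : ℝ)| := by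
  classical
  have hex : ∃ s, T ^ r * (T ^ m - 1) ^ s = 0 := ⟨r, hTm⟩
  obtain ⟨s, hs⟩ : ∃ s, Nat.find hex = s + 2 := by
    refine Nat.exists_eq_add_of_le' ?_
    rw [Nat.le_find_iff]
    intro s hs h
    interval_cases s
    · rw [pow_zero, mul_one] at h
      exact hT r 1 one_pos (by rw [pow_add, h, zero_mul])
    · rw [pow_one, mul_sub, mul_one, ← pow_add, sub_eq_zero] at h
      exact hT r m hm h
  have hzero : T ^ r * (T ^ m - 1) ^ (s + 2) = 0 := hs ▸ Nat.find_spec hex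
  have hne : T ^ r * (T ^ m - 1) ^ (s + 1) ≠ 0 := Nat.find_min hex (by omega)
  set P := T ^ r * (T ^ m - 1) ^ (s + 1) with hP
  set Q := T ^ r * (T ^ m - 1) ^ s with hQ
  have hc : Commute (T ^ m - 1) (T ^ r) :=
    (Commute.pow_pow_self T m r).sub_left (Commute.one_left _)
  have hBQ : T ^ m * Q = Q + P := by
    have : (T ^ m - 1) * Q = P := by
      rw [hP, hQ, ← mul_assoc, hc.eq, mul_assoc, ← pow_succ']
    rw [← this, sub_mul, one_mul, add_sub_cancel]
  have hBP : T ^ m * P = P := by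
    have : (T ^ m - 1) * P = 0 := by
      rw [← hzero, hP, ← mul_assoc, hc.eq, mul_assoc, ← pow_succ']
    rw [sub_mul, one_mul, sub_eq_zero] at this
    exact this
  have hpow : ∀ n : ℕ, T ^ (m * n) * Q = Q + n • P := by
    intro n
    induction n with
    | zero => simp
    | succ n ih =>
      rw [mul_add, mul_one, add_comm, pow_add, mul_assoc, ih, mul_add, hBQ, mul_smul_comm, hBP,
        succ_nsmul]
      abel
  obtain ⟨v, hv⟩ : ∃ v, P v ≠ 0 := by
    by_contra! h
    exact hne (LinearMap.ext h)
  obtain ⟨t, ht⟩ : ∃ t, e (P v) t ≠ 0 := by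
    by_contra! h
    exact hv (he (by rw [map_zero]; exact funext h))
  obtain ⟨x, hx⟩ := (Submodule.mem_span_range_iff_exists_fun ℤ).mp
    (hg ▸ Submodule.mem_top : Q v ∈ Submodule.span ℤ (Set.range g))
  refine ⟨t, exists_linear_growth_of_sum (fun n j => e ((T ^ (m * n)) (g j)) t)
    (fun j => (x j : ℂ)) (1 / 2) (by norm_num) (2 * (e (Q v) t).natAbs) fun n hn => ?_⟩
  have hsum : ∑ j, x j * e ((T ^ (m * n)) (g j)) t = e (Q v) t + n * e (P v) t := by
    have h1 : ∑ j, x j * e ((T ^ (m * n)) (g j)) t = e ((T ^ (m * n)) (Q v)) t := by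
      rw [← hx]
      simp [Finset.sum_apply]
    rw [h1, ← Module.End.mul_apply, hpow n]
    simp
  have hsumC : ∑ j, (x j : ℂ) * (e ((T ^ (m * n)) (g j)) t : ℂ)
      = ((e (Q v) t + n * e (P v) t : ℤ) : ℂ) := by
    rw [← hsum]; push_cast; rfl
  rw [hsumC, Complex.norm_intCast]
  have h1 : 1 ≤ |(e (P v) t : ℝ)| := by exact_mod_cast Int.one_le_abs ht
  have h2 : 2 * |(e (Q v) t : ℝ)| ≤ n := by
    have : ((2 * (e (Q v) t).natAbs : ℕ) : ℝ) ≤ n := by exact_mod_cast hn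
    simpa [Nat.cast_natAbs] using this
  have h3 : |(n : ℝ) * e (P v) t| ≤ |(e (Q v) t : ℝ) + n * e (P v) t| + |(e (Q v) t : ℝ)| := by
    have := abs_sub ((e (Q v) t : ℝ) + n * e (P v) t) (e (Q v) t : ℝ)
    simpa using this
  rw [abs_mul, Nat.abs_cast] at h3
  have h4 : (n : ℝ) * 1 ≤ n * |(e (P v) t : ℝ)| := by gcongr
  push_cast
  linarith

/-- Growth when `T` has a complex eigenvalue `μ` outside the closed unit disc: on an eigenvector in
`ℂ ⊗ V` the powers of `T` grow like `‖μ‖ ^ n`. -/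
theorem linear_growth_of_one_lt_norm {d : ℕ} (b : Module.Basis (Fin d) ℤ V)
    (he : Function.Injective e) (hg : Submodule.span ℤ (Set.range g) = ⊤) (μ : ℂ)
    (hμ : 1 < ‖μ‖)
    (hroot : μ ∈ ((LinearMap.toMatrixAlgEquiv b T).charpoly.map (Int.castRingHom ℂ)).roots) :
    ∃ (t : X) (c : ℝ), 0 < c ∧
      ∃ N : ℕ, ∀ n : ℕ, N ≤ n → ∃ j, c * n ≤ |(e ((T ^ n) (g j)) t : ℝ)| := by
  set A := (Int.castRingHom ℂ).mapMatrix (LinearMap.toMatrixAlgEquiv b T) with hA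
  obtain ⟨x, hx0, hx⟩ : ∃ x, x ≠ 0 ∧ A.mulVec x = μ • x := by
    have h := Polynomial.isRoot_of_mem_roots hroot
    have hchar : (LinearMap.toMatrixAlgEquiv b T).charpoly.map (Int.castRingHom ℂ) =
      (Matrix.toLin' A).charpoly := by
      rw [← Matrix.charpoly_map, Matrix.charpoly_toLin']; rfl
    rw [hchar, ← Module.End.hasEigenvalue_iff_isRoot_charpoly] at h
    obtain ⟨x, hx⟩ := h.exists_hasEigenvector
    exact ⟨x, hx.2, by simpa using hx.apply_eq_smul⟩
  have hxn : ∀ n : ℕ, (A ^ n).mulVec x = μ ^ n • x := by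
    intro n
    induction n with
    | zero => simp
    | succ n ih => rw [pow_succ, ← Matrix.mulVec_mulVec, hx, Matrix.mulVec_smul, ih, smul_smul,
        pow_succ']
  obtain ⟨t, ht⟩ : ∃ t, ∑ i, x i * (e (b i) t : ℂ) ≠ 0 := by
    by_contra! h
    exact hx0 (eq_zero_of_sum_mul_intCast_eq_zero (fun i => e (b i))
      (b.linearIndependent.map' e (LinearMap.ker_eq_bot.mpr he)) x h)
  choose C hC using fun i => (Submodule.mem_span_range_iff_exists_fun ℤ).mp
    (hg ▸ Submodule.mem_top : b i ∈ Submodule.span ℤ (Set.range g))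
  set h := ∑ i, x i * (e (b i) t : ℂ)
  have hpos : 0 < ‖h‖ := norm_pos_iff.mpr ht
  refine ⟨t, exists_linear_growth_of_sum (fun n l => e ((T ^ n) (g l)) t)
    (fun l => ∑ j, x j * (C j l : ℂ)) ((‖μ‖ - 1) * ‖h‖) (mul_pos (by linarith) hpos) 0
    fun n _ => ?_⟩
  have hb : ∀ j, (e ((T ^ n) (b j)) t : ℂ) = ∑ i, (A ^ n) i j * (e (b i) t : ℂ) := by
    intro j
    have h1 : (T ^ n) (b j) = ∑ i, LinearMap.toMatrixAlgEquiv b (T ^ n) i j • b i := by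
      simp_rw [LinearMap.toMatrixAlgEquiv_apply]
      exact (b.sum_repr _).symm
    have h2 : ∀ i, (A ^ n) i j = ((LinearMap.toMatrixAlgEquiv b (T ^ n) i j : ℤ) : ℂ) := by
      intro i
      rw [hA, ← map_pow, ← map_pow]; rfl
    rw [h1]
    simp [h2, Finset.sum_apply]
  have hgj : ∀ j, (e ((T ^ n) (b j)) t : ℂ) = ∑ l, (C j l : ℂ) * (e ((T ^ n) (g l)) t : ℂ) := by
    intro j
    rw [← hC j]
    simp [Finset.sum_apply]
  have hsum : ∑ l, (∑ j, x j * (C j l : ℂ)) * (e ((T ^ n) (g l)) t : ℂ) = μ ^ n * h := by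
    calc _ = ∑ j, x j * (e ((T ^ n) (b j)) t : ℂ) := by
          simp_rw [hgj, Finset.mul_sum, Finset.sum_mul]
          rw [Finset.sum_comm]
          simp_rw [mul_assoc]
      _ = ∑ i, ((A ^ n).mulVec x) i * (e (b i) t : ℂ) := by
          simp_rw [hb, Matrix.mulVec, dotProduct, Finset.mul_sum, Finset.sum_mul]
          rw [Finset.sum_comm]
          exact Finset.sum_congr rfl fun i _ => Finset.sum_congr rfl fun j _ => by ring
      _ = μ ^ n * h := by
          rw [hxn, Finset.mul_sum]
          exact Finset.sum_congr rfl fun i _ => by simp [mul_assoc]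
  rw [hsum, norm_mul, norm_pow]
  have hbern := one_add_mul_sub_le_pow (a := ‖μ‖) (by linarith) n
  nlinarith

/-- If an endomorphism `T` of a finitely generated `ℤ`-module of integer-valued functions has
infinitely many distinct powers, then for some `m` the values at some point of the powers of `T ^ m`
on a given generating family grow at least linearly. -/
theorem exists_linear_growth_of_not_torsion (he : Function.Injective e)
    (hT : ∀ a p : ℕ, 0 < p → T ^ (a + p) ≠ T ^ a)
    (hg : Submodule.span ℤ (Set.range g) = ⊤) :
    ∃ (m : ℕ) (t : X) (c : ℝ), 0 < c ∧
      ∃ N : ℕ, ∀ n : ℕ, N ≤ n → ∃ j, c * n ≤ |(e ((T ^ (m * n)) (g j)) t : ℝ)| := by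
  have hfin : Module.Finite ℤ V := ⟨hg ▸ Submodule.fg_span (Set.finite_range g)⟩
  have htf : Module.IsTorsionFree ℤ V := he.moduleIsTorsionFree e (fun n v => map_smul e n v)
  let b := Module.finBasis ℤ V
  set M := LinearMap.toMatrixAlgEquiv b T with hM
  by_cases h : ∃ μ ∈ (M.charpoly.map (Int.castRingHom ℂ)).roots, 1 < ‖μ‖
  · obtain ⟨μ, hroot, hμ⟩ := h
    obtain ⟨t, c, hc⟩ := linear_growth_of_one_lt_norm e T g b he hg μ hμ hroot
    exact ⟨1, t, c, by simpa using hc⟩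
  · push Not at h
    obtain ⟨m, r, hm, hdvd⟩ := exists_dvd_pow_of_norm_roots_le_one _ M.charpoly_monic h
    have hzero : T ^ r * (T ^ m - 1) ^ r = 0 := by
      obtain ⟨q, hq⟩ := hdvd
      have h0 : Polynomial.aeval M ((Polynomial.X * (Polynomial.X ^ m - 1)) ^ r :
          Polynomial ℤ) = 0 := by
        rw [hq, map_mul, Matrix.aeval_self_charpoly, zero_mul]
      apply (LinearMap.toMatrixAlgEquiv b).injective
      rw [mul_pow, map_mul] at h0
      simpa using h0
    exact ⟨m, linear_growth_of_unipotent e T g he hT hg m r hm hzero⟩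

end Growth

/-- The Burnside property over `ℤ`, by passing to rational matrices. -/
theorem finite_range_of_torsion_int {ι V : Type*} [Finite ι] [AddCommGroup V] [Module.Free ℤ V]
    [Module.Finite ℤ V] (ρ : FreeMonoid ι →* Module.End ℤ V)
    (htors : ∀ g, ∃ a p : ℕ, 0 < p ∧ ρ g ^ (a + p) = ρ g ^ a) : (Set.range ρ).Finite := by
  let b := Module.finBasis ℤ V
  let σ : Module.End ℤ V →* Module.End ℚ (Fin (Module.finrank ℤ V) → ℚ) :=
    (Matrix.toLinAlgEquiv' : Matrix _ _ ℚ ≃ₐ[ℚ] _).toRingEquiv.toMonoidHom.comp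
      ((Int.castRingHom ℚ).mapMatrix.toMonoidHom.comp
        (LinearMap.toMatrixAlgEquiv b).toRingEquiv.toMonoidHom)
  have hσ : Function.Injective σ :=
    (Matrix.toLinAlgEquiv' : Matrix _ _ ℚ ≃ₐ[ℚ] _).injective.comp
      ((Matrix.map_injective Int.cast_injective).comp (LinearMap.toMatrixAlgEquiv b).injective)
  have h := finite_range_of_torsion (σ.comp ρ) fun g => by
    obtain ⟨a, p, hp, h⟩ := htors g
    exact ⟨a, p, hp, by rw [MonoidHom.comp_apply, ← map_pow, h, map_pow]⟩
  rw [MonoidHom.coe_comp, Set.range_comp] at h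
  exact h.of_finite_image hσ.injOn

/-! ### The action of words on the span of the kernel -/

/-- In `wordValue` the letters are coerced to `ℕ` through the monad structure of `List`; the value
is that of `List.map`. -/
theorem wordValue_eq_ofDigits {k : ℕ} (w : List (Fin k)) :
    wordValue w = Nat.ofDigits k (w.reverse.map Fin.val) := by
  simp [wordValue, ← List.map_eq_flatMap, Function.comp_def]

theorem wordValue_nil {k : ℕ} : wordValue ([] : List (Fin k)) = 0 := rfl

theorem wordValue_append {k : ℕ} (u v : List (Fin k)) :
    wordValue (u ++ v) = k ^ v.length * wordValue u + wordValue v := by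
  simp only [wordValue_eq_ofDigits, List.reverse_append, List.map_append, Nat.ofDigits_append,
    List.length_map, List.length_reverse]
  ring

theorem wordValue_singleton {k : ℕ} (i : Fin k) : wordValue [i] = i := by
  simp [wordValue_eq_ofDigits]

theorem wordValue_lt_pow_length {k : ℕ} (hk : 2 ≤ k) (w : List (Fin k)) :
    wordValue w < k ^ w.length := by
  have := Nat.ofDigits_lt_base_pow_length (b := k) (l := w.reverse.map Fin.val) hk
    (by simp only [List.mem_map]; rintro _ ⟨i, -, rfl⟩; exact i.2)
  simpa [wordValue_eq_ofDigits] using this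

/-- Leading zeros are allowed, so each `r < k ^ l` is the value of a word of length exactly `l`. -/
theorem exists_wordValue_eq {k : ℕ} (l r : ℕ) (h : r < k ^ l) :
    ∃ w : List (Fin k), w.length = l ∧ wordValue w = r := by
  induction l generalizing r with
  | zero => exact ⟨[], rfl, by simp at h; rw [h, wordValue_nil]⟩
  | succ l ih =>
    have hk : 0 < k := Nat.pos_of_ne_zero (by rintro rfl; simp at h)
    obtain ⟨w, hl, hw⟩ := ih (r / k) (Nat.div_lt_of_lt_mul (by rwa [pow_succ'] at h))
    refine ⟨w ++ [⟨r % k, Nat.mod_lt _ hk⟩], by simp [hl], ?_⟩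
    rw [wordValue_append, wordValue_singleton, hw, List.length_singleton, pow_one]
    exact Nat.div_add_mod r k

/-- The action of words on sequences: the letter `i` acts as `g ↦ (n ↦ g (k * n + i))`. -/
def wordAction (k : ℕ) : FreeMonoid (Fin k) →* Module.End ℤ (ℕ → ℤ) :=
  FreeMonoid.lift fun i => LinearMap.funLeft ℤ ℤ fun n => k * n + i

theorem wordAction_apply {k : ℕ} (w : FreeMonoid (Fin k)) (g : ℕ → ℤ) :
    wordAction k w g = fun n => g (k ^ w.toList.length * n + wordValue w.toList) := by
  induction w using FreeMonoid.inductionOn' generalizing g with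
  | one => simp [wordValue_nil]
  | of_mul i w ih =>
    rw [map_mul, Module.End.mul_apply, ih]
    funext n
    have h := wordValue_append [i] w.toList
    simp only [FreeMonoid.toList_mul, FreeMonoid.toList_of, h, wordValue_singleton,
      List.length_append, List.length_singleton, pow_add, pow_one, wordAction,
      FreeMonoid.lift_eval_of, LinearMap.funLeft_apply]
    congr 1
    ring

theorem wordAction_wordValue {k : ℕ} (u w : List (Fin k)) (g : ℕ → ℤ) :
    wordAction k (FreeMonoid.ofList w) g (wordValue u) = g (wordValue (u ++ w)) := by
  rw [wordAction_apply, wordValue_append]; rfl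

theorem wordAction_mem_span_kKernel {k : ℕ} (hk : 2 ≤ k) (f : ℕ → ℤ) (w : FreeMonoid (Fin k)) :
    ∀ g ∈ Submodule.span ℤ (kKernel k f), wordAction k w g ∈ Submodule.span ℤ (kKernel k f) := by
  intro g hg
  refine Submodule.span_induction (p := fun g _ => wordAction k w g ∈ _) ?_ (by simp) ?_ ?_ hg
  · rintro _ ⟨l, r, hr, rfl⟩
    refine Submodule.subset_span ⟨l + w.toList.length, k ^ l * wordValue w.toList + r, ?_, ?_⟩
    · have h := wordValue_lt_pow_length hk w.toList
      calc _ < k ^ l * wordValue w.toList + k ^ l := by omega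
        _ = k ^ l * (wordValue w.toList + 1) := by ring
        _ ≤ _ := by rw [pow_add]; exact Nat.mul_le_mul_left _ h
    · rw [wordAction_apply]
      funext n
      congr 1
      ring
  · intro x y _ _ hx hy
    rw [map_add]; exact Submodule.add_mem _ hx hy
  · intro c x _ hx
    rw [map_smul]; exact Submodule.smul_mem _ c hx

/-- The action of words restricted to the span of the `k`-kernel of `f`. -/
def kernelAction {k : ℕ} (hk : 2 ≤ k) (f : ℕ → ℤ) :
    FreeMonoid (Fin k) →* Module.End ℤ (Submodule.span ℤ (kKernel k f)) where
  toFun w := (wordAction k w).restrict (wordAction_mem_span_kKernel hk f w)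
  map_one' := by ext; simp
  map_mul' w w' := by ext; simp

theorem coe_kernelAction {k : ℕ} (hk : 2 ≤ k) (f : ℕ → ℤ) (w : FreeMonoid (Fin k))
    (g : Submodule.span ℤ (kKernel k f)) :
    (kernelAction hk f w g : ℕ → ℤ) = wordAction k w g := rfl

theorem mem_span_kKernel_self (k : ℕ) (f : ℕ → ℤ) : f ∈ Submodule.span ℤ (kKernel k f) :=
  Submodule.subset_span ⟨0, 0, by simp, by simp⟩

theorem ofList_wordPow {k : ℕ} (y : List (Fin k)) (n : ℕ) :
    FreeMonoid.ofList (wordPow y n) = FreeMonoid.ofList y ^ n := by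
  induction n with
  | zero => rfl
  | succ n ih =>
    rw [pow_succ', ← ih, wordPow, List.replicate_succ, List.flatten_cons, FreeMonoid.ofList_append]
    rfl

theorem wordPow_wordPow {k : ℕ} (y : List (Fin k)) (m n : ℕ) :
    wordPow (wordPow y m) n = wordPow y (m * n) := by
  apply FreeMonoid.ofList.injective
  rw [ofList_wordPow, ofList_wordPow, ofList_wordPow, pow_mul]

theorem length_wordPow {k : ℕ} (y : List (Fin k)) (n : ℕ) :
    (wordPow y n).length = n * y.length := by
  simp [wordPow]

/-- An unbounded regular sequence has a word acting with infinitely many distinct powers. -/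
theorem exists_not_torsion_word {k : ℕ} (hk : 2 ≤ k) (f : ℕ → ℤ) (hreg : IsKRegular k f)
    (hunb : ∀ B : ℤ, ∃ n : ℕ, B < |f n|) :
    ∃ y, ∀ a p : ℕ, 0 < p → kernelAction hk f y ^ (a + p) ≠ kernelAction hk f y ^ a := by
  by_contra! h
  have : Module.Finite ℤ (Submodule.span ℤ (kKernel k f)) := Module.Finite.iff_fg.mpr hreg
  have hfin := finite_range_of_torsion_int (kernelAction hk f) h
  let f' : Submodule.span ℤ (kKernel k f) := ⟨f, mem_span_kKernel_self k f⟩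
  obtain ⟨B, hB⟩ := (hfin.image (fun M => |(M f' : ℕ → ℤ) 0|)).bddAbove
  obtain ⟨n, hn⟩ := hunb B
  obtain ⟨w, -, rfl⟩ := exists_wordValue_eq (k := k) n n (Nat.lt_pow_self hk)
  have h0 := hB ⟨_, ⟨FreeMonoid.ofList w, rfl⟩, rfl⟩
  have h1 := wordAction_wordValue [] w f
  simp only [coe_kernelAction, f'] at h0
  rw [wordValue_nil, List.nil_append] at h1
  rw [h1] at h0
  omega

/-! ### Growth along pumped words -/

/-- The linear lower bound along a family of pumped words. The words `v j` come from finitely many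
elements of the kernel that span the same module, and one prefix `u` suffices. -/
theorem exists_pumped_words {k : ℕ} (hk : 2 ≤ k) (f : ℕ → ℤ) (hreg : IsKRegular k f)
    (hunb : ∀ B : ℤ, ∃ n : ℕ, B < |f n|) :
    ∃ (m : ℕ) (u y : List (Fin k)) (v : Fin m → List (Fin k)) (c : ℝ), 0 < c ∧
      ∃ N : ℕ, ∀ n : ℕ, N ≤ n → ∃ j,
        c * (n : ℝ) ≤ |(f (wordValue (u ++ wordPow y n ++ v j)) : ℝ)| := by
  obtain ⟨y, hy⟩ := exists_not_torsion_word hk f hreg hunb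
  let f' : Submodule.span ℤ (kKernel k f) := ⟨f, mem_span_kKernel_self k f⟩
  obtain ⟨s, hs, hspan⟩ := (Submodule.fg_span_iff_fg_span_finset_subset _).mp hreg
  have hword : ∀ x : s, ∃ w, (x : ℕ → ℤ) = wordAction k (FreeMonoid.ofList w) f := by
    rintro ⟨x, hx⟩
    obtain ⟨l, r, hr, rfl⟩ := hs hx
    obtain ⟨w, hl, hw⟩ := exists_wordValue_eq l r hr
    exact ⟨w, by rw [wordAction_apply, FreeMonoid.toList_ofList, hl, hw]⟩
  choose v hv using hword
  let g : s → Submodule.span ℤ (kKernel k f) := fun x => kernelAction hk f (.ofList (v x)) f'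
  have hg : Submodule.span ℤ (Set.range g) = ⊤ := by
    apply Submodule.map_injective_of_injective (Submodule.injective_subtype _)
    rw [Submodule.map_span, Submodule.map_top, Submodule.range_subtype, ← Set.range_comp]
    conv_rhs => rw [hspan]
    congr 1
    ext x
    constructor
    · rintro ⟨x, rfl⟩
      have : g x = (x : ℕ → ℤ) := (hv x).symm
      simp [this]
    · exact fun hx => ⟨⟨x, hx⟩, (hv ⟨x, hx⟩).symm⟩
  obtain ⟨m, t, c, hc, N, hN⟩ := exists_linear_growth_of_not_torsion
    (Submodule.subtype _) (kernelAction hk f y) g (Submodule.injective_subtype _) hy hg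
  obtain ⟨u, -, rfl⟩ := exists_wordValue_eq (k := k) t t (Nat.lt_pow_self hk)
  refine ⟨Fintype.card s, u, wordPow y.toList m, v ∘ (Fintype.equivFin s).symm, c, hc, N,
    fun n hn => ?_⟩
  obtain ⟨j, hj⟩ := hN n hn
  refine ⟨Fintype.equivFin s j, hj.trans_eq ?_⟩
  have h : (kernelAction hk f y ^ (m * n)) (g j) =
      kernelAction hk f (.ofList (wordPow y.toList (m * n) ++ v j)) f' := by
    rw [FreeMonoid.ofList_append, ofList_wordPow, map_mul, map_pow]; rfl
  rw [h, Submodule.subtype_apply, coe_kernelAction, wordAction_wordValue, wordPow_wordPow,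
    Function.comp_apply, Equiv.symm_apply_apply, List.append_assoc]

/-- Pumped words have values that grow at most exponentially, so linear growth in the exponent is
at least logarithmic growth in the value. -/
theorem infinite_log_lt_of_pumped_words {k : ℕ} (hk : 2 ≤ k) (f : ℕ → ℤ) {m : ℕ}
    (u y : List (Fin k)) (v : Fin m → List (Fin k)) (c₀ : ℝ) (hc₀ : 0 < c₀) (N : ℕ)
    (h : ∀ n : ℕ, N ≤ n → ∃ j,
      c₀ * (n : ℝ) ≤ |(f (wordValue (u ++ wordPow y n ++ v j)) : ℝ)|) :
    ∃ c : ℝ, 0 < c ∧ {n : ℕ | c * Real.log (n : ℝ) < |(f n : ℝ)|}.Infinite := by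
  set L := u.length + y.length + ∑ j, (v j).length
  have hlogk : 0 < Real.log k := Real.log_pos (by exact_mod_cast hk)
  set D : ℝ := 3 * (L + 1) * Real.log k with hD
  have hDpos : 0 < D := by positivity
  refine ⟨c₀ / (2 * D), by positivity, fun hfin => ?_⟩
  obtain ⟨B, hB⟩ := (hfin.image fun n => |(f n : ℝ)|).bddAbove
  obtain ⟨n₁, hn₁⟩ := exists_nat_gt (B / c₀)
  set n := max (max N 1) n₁
  obtain ⟨j, hj⟩ := h n (by omega)
  set w := u ++ wordPow y n ++ v j
  have hn1 : (1 : ℝ) ≤ n := by exact_mod_cast (by omega : 1 ≤ n)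
  have hlen : w.length ≤ 3 * (L + 1) * n := by
    have hv : (v j).length ≤ ∑ j, (v j).length :=
      Finset.single_le_sum (f := fun j => (v j).length) (fun _ _ => Nat.zero_le _)
        (Finset.mem_univ j)
    have : w.length = u.length + n * y.length + (v j).length := by
      simp [w, length_wordPow, add_assoc]
    have hn : 1 ≤ n := by omega
    calc w.length = u.length * 1 + n * y.length + (v j).length * 1 := by rw [this]; ring
      _ ≤ L * n + n * L + L * n := by gcongr <;> omega
      _ ≤ 3 * (L + 1) * n := by ring_nf; omega
  have hlog : Real.log (wordValue w) ≤ D * n := by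
    have h1 : Real.log (wordValue w) ≤ Real.log ((k : ℝ) ^ w.length) := by
      rcases Nat.eq_zero_or_pos (wordValue w) with h0 | h0
      -- the value zero is allowed, since `Real.log 0 = 0`
      · rw [h0, Nat.cast_zero, Real.log_zero, Real.log_pow]; positivity
      · exact Real.log_le_log (by exact_mod_cast h0)
          (by exact_mod_cast (wordValue_lt_pow_length hk w).le)
    rw [Real.log_pow] at h1
    have h2 : (w.length : ℝ) ≤ 3 * (L + 1) * n := by exact_mod_cast hlen
    calc _ ≤ _ := h1
      _ ≤ 3 * (L + 1) * n * Real.log k := by gcongr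
      _ = D * n := by rw [hD]; ring
  have hmem : wordValue w ∈ {n : ℕ | c₀ / (2 * D) * Real.log (n : ℝ) < |(f n : ℝ)|} := by
    calc c₀ / (2 * D) * Real.log (wordValue w) ≤ c₀ / (2 * D) * (D * n) := by gcongr
      _ = c₀ * n / 2 := by field_simp
      _ < c₀ * n := half_lt_self (by positivity)
      _ ≤ _ := hj
  have h1 := hB ⟨_, hmem, rfl⟩
  have h2 : (n₁ : ℝ) ≤ n := by exact_mod_cast le_max_right _ _
  have h3 : B < c₀ * n := by
    rw [div_lt_iff₀ hc₀] at hn₁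
    nlinarith
  linarith

theorem theorem1 (k : ℕ) (hk : 2 ≤ k) (f : ℕ → ℤ) (hreg : IsKRegular k f)
    (hunb : ∀ B : ℤ, ∃ n : ℕ, B < |f n|) :
    (∃ c : ℝ, 0 < c ∧ {n : ℕ | c * Real.log (n : ℝ) < |(f n : ℝ)|}.Infinite) ∧
    (∃ (m : ℕ) (u v : Fin m → List (Fin k)) (y : List (Fin k)) (c₀ : ℝ), 0 < c₀ ∧
      ∃ N : ℕ, ∀ n : ℕ, N ≤ n → ∃ i j : Fin m,
        c₀ * (n : ℝ) ≤ |(f (wordValue (u i ++ wordPow y n ++ v j)) : ℝ)|) := by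
  obtain ⟨m, u, y, v, c₀, hc₀, N, h⟩ := exists_pumped_words hk f hreg hunb
  refine ⟨infinite_log_lt_of_pumped_words hk f u y v c₀ hc₀ N h,
    m, fun _ => u, v, y, c₀, hc₀, N, fun n hn => ?_⟩
  obtain ⟨j, hj⟩ := h n hn
  exact ⟨j, j, hj⟩
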